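/- \textbf{Setting.} Let $(W,S)$ be a Coxeter system with Coxeter matrix $(m_{st})$ and length function $\ell$. For $I\subseteq S$ let $W_I$ be the subgroup generated by $I$; $I$ is \emph{finitary} if $W_I$ is finite, and then $w_I$ denotes the longest element of $W_I$. For finitary $I,J$, an $(I,J)$-coset is an element $q$ of $W_I\backslash W/W_J$; $\underline q$ and $\overline q$ are its minimal and maximal elements, and $q\le p$ means $\underline q\le\underline p$ in the Bruhat order. Put $\mathrm{LR}(q)=I\cap \underline q J\underline q^{-1}$ and $\mathrm{RR}(q)=\underline q^{-1}I\underline q\cap J$, and let $q^{\mathrm{core}}$ be the $(\mathrm{LR}(q),\mathrm{RR}(q))$-coset containing $\underline q$. A \emph{realization} of $(W,S)$ over a commutative ring $\Bbbk$ is a free $\Bbbk$-module $V$ of finite rank with elements $\alpha_s\in V$ and $\alpha_s^\vee\in V^*=\operatorname{Hom}_\Bbbk(V,\Bbbk)$ $(s\in S)$ such that $\alpha_s^\vee(\alpha_s)=2$, the formula $s(v)=v-\alpha_s^\vee(v)\alpha_s$ defines an action of $W$ on $V$, and $[m_{st}]_{x,y}=0$ for $s\ne t$ with $m_{st}<\infty$,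 where $x=-\alpha_s^\vee(\alpha_t)$, $y=-\alpha_t^\vee(\alpha_s)$, and $[0]_{x,y}=0$, $[1]_{x,y}=1$, $[n+2]_{x,y}=x[n+1]_{y,x}-[n]_{x,y}$. Let $R=\operatorname{Sym}_\Bbbk(V)$ with the induced $W$-action and $R^I=R^{W_I}$. The Demazure operator $\partial_s:R\to R$ is the $\Bbbk$-linear map equal to $\alpha_s^\vee$ on $V$ with $\partial_s(fg)=s(f)\partial_s(g)+\partial_s(f)g$; for $w=s_1\cdots s_n$ reduced, $\partial_w=\partial_{s_1}\cdots\partial_{s_n}$. For an $(I,J)$-coset $q$ put $\partial_q=\partial_{\overline q w_J^{-1}}$, and for $K\subseteq I$ finitary put $\partial^K_I=\partial_{w_Iw_K^{-1}}$. The realization is \emph{Frobenius} if (i) it is balanced: $[m_{st}-1]_{x,y}=1$ for all $s\neq t$ with $m_{st}<\infty$; (ii) it satisfies generalized Demazure surjectivity: all $\alpha_s:V^*\to\Bbbk$ and $\alpha_s^\vee:V\to\Bbbk$ are surjective, and $\partial_{w_I}$ maps $R$ onto $R^I$ for every finitary $I$; (iii) each finite $W_I$ acts faithfully on $V$. Let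 $M\subseteq S$ be finitary, $s\in M$, $t=w_Msw_M$, $I=M\setminus\{s\}$, $J=M\setminus\{t\}$, and let $\mathtt a$ be the $(I,J)$-coset containing $w_M$ (an \emph{atomic} coset). A \emph{rightward atomic Leibniz rule} holds for $\mathtt a$ if there are $R^M$-linear maps $T_q:R^J\to R^{\mathrm{RR}(q)}$, one for each $(I,J)$-coset $q<\mathtt a$, such that for all $f,g\in R^J$ \[\partial_{\mathtt a}(fg)=\underline{\mathtt a}(f)\,\partial_{\mathtt a}(g)+\sum_{q<\mathtt a}\partial_{\overline q w_J^{-1}}\bigl(T_q(f)\,g\bigr).\] A \emph{leftward atomic Leibniz rule} holds for $\mathtt a$ if there are $R^M$-linear maps $T'_q:R^J\to R^{\mathrm{LR}(q)}$, $q<\mathtt a$, such that for all $f,g\in R^J$ \[\partial_{\mathtt a}(fg)=\underline{\mathtt a}(f)\,\partial_{\mathtt a}(g)+\sum_{q<\mathtt a}\partial^{\mathrm{LR}(q)}_I\bigl(T'_q(f)\,\partial_{q^{\mathrm{core}}}(g)\bigr).\] From a realization $(V,\alpha,\alpha^\vee)$ one obtains new realizations of $(W,S)$: its \emph{specializations}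 $V\otimes_\Bbbk\Bbbk'$, for a commutative $\Bbbk$-algebra $\Bbbk'$, with roots $\alpha_s\otimes1$ and the $\Bbbk'$-linear extensions of the coroots; its \emph{$W$-invariant enlargements} $V\oplus N$, for a free $\Bbbk$-module $N$ of finite rank, with roots $(\alpha_s,0)$ and coroots extended by $0$ on $N$; and its \emph{$W$-invariant quotients} $Y\cong V/X$, for a decomposition $V=X\oplus Y$ into free $\Bbbk$-modules such that $W$ acts trivially on $X$ and such that the image $\overline{\alpha}_s$ of each $\alpha_s$ in $Y$ induces a surjection $Y^*\to\Bbbk$, with roots $\overline{\alpha}_s$ and the induced coroots (the old coroots vanish on $X$). \textbf{Lemma.} Let $V$ be a Frobenius realization of $(W,S)$ and let $\mathtt a$ be an atomic coset. If a rightward (resp. leftward) atomic Leibniz rule holds for $\mathtt a$ and $V$, then a rightward (resp. leftward) atomic Leibniz rule holds for $\mathtt a$ and every specialization, every $W$-invariant enlargement and every $W$-invariant quotient of $V$. -/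

import Mathlib

open scoped TensorProduct

universe uB uW uk uV uk' uN

noncomputable section

namespace AtomicLeibniz

/-! ### Coxeter systems: parabolic subgroups, Bruhat order, double cosets -/

section Coxeter

variable {B : Type uB} {W : Type uW} [Group W] {m : CoxeterMatrix B} (cs : CoxeterSystem m W)

/-- The parabolic subgroup `W_I` generated by the simple reflections in `I`. -/
def parabolic (I : Set B) : Subgroup W := Subgroup.closure (cs.simple '' I)

/-- `I` is finitary if `W_I` is a finite group. -/
def Finitary (I : Set B) : Prop := Finite (parabolic cs I)

/-- An element of minimal length in a set `A` of elements of `W`. -/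
def shortest (A : Set W) : W :=
  Classical.epsilon fun w => w ∈ A ∧ ∀ v ∈ A, cs.length w ≤ cs.length v

/-- An element of maximal length in a (finite nonempty) set `A` of elements of `W`. -/
def longest (A : Set W) : W :=
  Classical.epsilon fun w => w ∈ A ∧ ∀ v ∈ A, cs.length v ≤ cs.length w

theorem shortest_spec {A : Set W} (hA : A.Nonempty) :
    shortest cs A ∈ A ∧ ∀ v ∈ A, cs.length (shortest cs A) ≤ cs.length v := by
  refine Classical.epsilon_spec (p := fun w => w ∈ A ∧ ∀ v ∈ A, cs.length w ≤ cs.length v) ?_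
  obtain ⟨w, hw, h⟩ := exists_minimalFor_of_wellFoundedLT (· ∈ A) cs.length hA
  refine ⟨w, hw, fun v hv => ?_⟩
  rcases le_total (cs.length w) (cs.length v) with h' | h'
  · exact h'
  · exact h hv h'

theorem longest_spec {A : Set W} (hA : A.Nonempty) (hfin : A.Finite) :
    longest cs A ∈ A ∧ ∀ v ∈ A, cs.length v ≤ cs.length (longest cs A) :=
  Classical.epsilon_spec (p := fun w => w ∈ A ∧ ∀ v ∈ A, cs.length v ≤ cs.length w)
    (Set.exists_max_image A cs.length hfin hA)

/-- The longest element `w_I` of the parabolic subgroup `W_I` (for finitary `I`). -/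
def longestElement (I : Set B) : W := longest cs (parabolic cs I : Set W)

/-- The Bruhat order, through the subword property: `u ≤ w` if every reduced word for `w` contains
a reduced word for `u` as a subword. -/
def BruhatLE (u w : W) : Prop :=
  ∀ ω : List B, cs.IsReduced ω → cs.wordProd ω = w →
    ∃ ω' : List B, ω'.Sublist ω ∧ cs.IsReduced ω' ∧ cs.wordProd ω' = u

/-- An `(I,J)`-coset: an element of `W_I \ W / W_J`. -/
abbrev Coset (I J : Set B) : Type uW :=
  DoubleCoset.Quotient (parabolic cs I : Set W) (parabolic cs J : Set W)

/-- The `(I,J)`-coset `W_I w W_J` containing `w`. -/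
abbrev Coset.of (I J : Set B) (w : W) : Coset cs I J :=
  DoubleCoset.mk (parabolic cs I) (parabolic cs J) w

variable {cs} {I J : Set B}

/-- The underlying subset of `W` of an `(I,J)`-coset. -/
def Coset.toSet (q : Coset cs I J) : Set W := {w | Coset.of cs I J w = q}

/-- The minimal element of an `(I,J)`-coset. -/
def Coset.min (q : Coset cs I J) : W := shortest cs q.toSet

/-- The maximal element of an `(I,J)`-coset (for finitary `I` and `J`). -/
def Coset.max (q : Coset cs I J) : W := longest cs q.toSet

/-- The left redundancy `I ∩ q J q⁻¹`, where `q` stands for the minimal element of the coset. -/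
def Coset.leftRed (q : Coset cs I J) : Set B :=
  {i | i ∈ I ∧ ∃ j ∈ J, cs.simple i = q.min * cs.simple j * q.min⁻¹}

/-- The right redundancy `q⁻¹ I q ∩ J`, where `q` stands for the minimal element of the coset. -/
def Coset.rightRed (q : Coset cs I J) : Set B :=
  {j | j ∈ J ∧ ∃ i ∈ I, cs.simple j = q.min⁻¹ * cs.simple i * q.min}

/-- The core of an `(I,J)`-coset `q`: the `(leftRed q, rightRed q)`-coset with the same minimal
element. -/
def Coset.core (q : Coset cs I J) : Coset cs q.leftRed q.rightRed :=
  Coset.of cs q.leftRed q.rightRed q.min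

/-- The strict Bruhat order on `(I,J)`-cosets: comparison of the minimal elements. -/
def Coset.Lt (q p : Coset cs I J) : Prop := BruhatLE cs q.min p.min ∧ q ≠ p

theorem Coset.of_min (q : Coset cs I J) : Coset.of cs I J q.min = q := by
  have h : (q.toSet).Nonempty := ⟨q.out, DoubleCoset.out_eq' _ _ q⟩
  exact (shortest_spec cs h).1

theorem finite_bruhatLE (w : W) : {u | BruhatLE cs u w}.Finite := by
  obtain ⟨ω, hω, rfl⟩ := cs.exists_isReduced w
  refine Set.Finite.subset (s := cs.wordProd '' {ω' | ω' ∈ ω.sublists}) ?_ ?_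
  · exact (List.finite_toSet _).image _
  · intro u hu
    obtain ⟨ω', h, -, rfl⟩ := hu ω hω rfl
    exact ⟨ω', by simpa using h, rfl⟩

/-- There are only finitely many cosets below a given one. -/
instance Coset.finite_lt (p : Coset cs I J) : Finite {q : Coset cs I J // q.Lt p} := by
  have := (finite_bruhatLE (cs := cs) p.min).to_subtype
  refine Finite.of_injective
    (fun q : {q : Coset cs I J // q.Lt p} =>
      (⟨q.1.min, q.2.1⟩ : {u | BruhatLE cs u p.min})) ?_
  intro q q' h
  have h' : q.1.min = q'.1.min := congrArg Subtype.val h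
  apply Subtype.ext
  rw [← Coset.of_min q.1, ← Coset.of_min q'.1, h']

end Coxeter

section Atomic

variable {B : Type uB} {W : Type uW} [Group W] {m : CoxeterMatrix B} (cs : CoxeterSystem m W)

/-- The data of an atomic coset: a finitary subset `M`, an element `s` of `M` and the element
`t = w_M s w_M` of `M`. -/
structure AtomicDatum where
  M : Set B
  finitary : Finitary cs M
  s : B
  t : B
  s_mem : s ∈ M
  t_mem : t ∈ M
  conj : cs.simple t = longestElement cs M * cs.simple s * longestElement cs M

variable {cs}

/-- `I = M \ s`. -/
def AtomicDatum.I (d : AtomicDatum cs) : Set B := d.M \ {d.s}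

/-- `J = M \ t`. -/
def AtomicDatum.J (d : AtomicDatum cs) : Set B := d.M \ {d.t}

/-- The atomic coset: the `(I,J)`-coset containing `w_M`. -/
def AtomicDatum.coset (d : AtomicDatum cs) : Coset cs d.I d.J :=
  Coset.of cs d.I d.J (longestElement cs d.M)

theorem AtomicDatum.J_subset (d : AtomicDatum cs) : d.J ⊆ d.M := Set.sdiff_subset

theorem AtomicDatum.rightRed_subset (d : AtomicDatum cs) (q : Coset cs d.I d.J) :
    q.rightRed ⊆ d.M := fun _ hj => hj.1.1

theorem AtomicDatum.leftRed_subset (d : AtomicDatum cs) (q : Coset cs d.I d.J) :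
    q.leftRed ⊆ d.M := fun _ hi => hi.1.1

end Atomic

/-! ### Realizations -/

/-- Two-coloured quantum numbers: `[0]_x = 0`, `[1]_x = 1`, `[n+2]_x = x [n+1]_y - [n]_x`, where
`[n]_y` is `[n]_x` with `x` and `y` exchanged. -/
def quantumNumber {k : Type uk} [CommRing k] : ℕ → k → k → k
  | 0, _, _ => 0
  | 1, _, _ => 1
  | n + 2, x, y => x * quantumNumber (n + 1) y x - quantumNumber n x y

theorem map_quantumNumber {k : Type uk} {k' : Type uk'} [CommRing k] [CommRing k'] (φ : k →+* k')
    (n : ℕ) (x y : k) : φ (quantumNumber n x y) = quantumNumber n (φ x) (φ y) := by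
  induction n using Nat.strong_induction_on generalizing x y with
  | _ n ih =>
    match n with
    | 0 => simp [quantumNumber]
    | 1 => simp [quantumNumber]
    | n + 2 => simp [quantumNumber, ih (n + 1) (by omega), ih n (by omega)]

/-- The map `v ↦ v - f(v) a`. -/
def reflectionMap {k : Type uk} {V : Type uV} [CommRing k] [AddCommGroup V] [Module k V]
    (a : V) (f : Module.Dual k V) : Module.End k V := LinearMap.id - f.smulRight a

theorem reflectionMap_apply {k : Type uk} {V : Type uV} [CommRing k] [AddCommGroup V] [Module k V]
    (a : V) (f : Module.Dual k V) (v : V) : reflectionMap a f v = v - f v • a := by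
  simp [reflectionMap]

section Realization

/-- A realization of a Coxeter system `(W,S)` over `k`. The entries `m s t = ∞` of the Coxeter
matrix are encoded by `m s t = 0`; for those the last condition is void. -/
structure Realization {B : Type uB} {W : Type uW} [Group W] {m : CoxeterMatrix B}
    (cs : CoxeterSystem m W) (k : Type uk) (V : Type uV) [CommRing k] [AddCommGroup V]
    [Module k V] where
  free : Module.Free k V
  finite : Module.Finite k V
  root : B → V
  coroot : B → Module.Dual k V
  coroot_root : ∀ s, coroot s (root s) = 2
  /-- The reflections satisfy the Coxeter relations, hence define an action of `W` on `V`. -/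
  liftable : m.IsLiftable fun s => reflectionMap (root s) (coroot s)
  technical : ∀ s t, s ≠ t → quantumNumber (m s t) (-coroot s (root t)) (-coroot t (root s)) = 0

variable {B : Type uB} {W : Type uW} [Group W] {m : CoxeterMatrix B} {cs : CoxeterSystem m W}
variable {k : Type uk} {V : Type uV} [CommRing k] [AddCommGroup V] [Module k V]

namespace Realization

variable (R : Realization cs k V)

/-- The action of `W` on `V`. -/
def rep : W →* Module.End k V :=
  cs.lift ⟨fun s => reflectionMap (R.root s) (R.coroot s), R.liftable⟩

theorem rep_simple (s : B) : R.rep (cs.simple s) = reflectionMap (R.root s) (R.coroot s) :=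
  cs.lift_apply_simple R.liftable s

/-- The polynomial ring whose linear terms are `V`. -/
abbrev Poly (_R : Realization cs k V) : Type (max uk uV) := SymmetricAlgebra k V

/-- The action of `w ∈ W` on the polynomial ring by algebra endomorphisms. -/
def act (w : W) : R.Poly →ₐ[k] R.Poly :=
  SymmetricAlgebra.lift (SymmetricAlgebra.ι k V ∘ₗ R.rep w)

/-- The subring `R^I` of `W_I`-invariants. -/
def invariants (I : Set B) : Subalgebra k R.Poly where
  carrier := {f | ∀ w ∈ parabolic cs I, R.act w f = f}
  mul_mem' ha hb w hw := by rw [map_mul, ha w hw, hb w hw]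
  add_mem' ha hb w hw := by rw [map_add, ha w hw, hb w hw]
  algebraMap_mem' r w _ := (R.act w).commutes r

/-- For `I ⊆ M`, the ring `R^I` as a module over `R^M`. -/
def invariantsOver {I M : Set B} (h : I ⊆ M) : Submodule (R.invariants M) R.Poly where
  carrier := R.invariants I
  add_mem' := add_mem
  zero_mem' := zero_mem _
  smul_mem' c x hx := by
    have hc : (c : R.Poly) ∈ R.invariants I := fun w hw =>
      c.2 w (Subgroup.closure_mono (Set.image_mono h) hw)
    exact mul_mem hc hx

/-- The substitution `v ↦ v + α_s^∨(v) T` from the polynomial ring `R` to `R[T]`. -/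
def shift (s : B) : R.Poly →ₐ[k] Polynomial R.Poly :=
  SymmetricAlgebra.lift
    ((Polynomial.CAlgHom (R := k) (A := R.Poly)).toLinearMap ∘ₗ SymmetricAlgebra.ι k V
      + (R.coroot s).smulRight (Polynomial.X : Polynomial R.Poly))

/-- The Demazure operator `∂_s`, as the divided difference `(f - s f) / α_s`. Writing `F(T)` for
the image of `f` under `v ↦ v + α_s^∨(v) T`, one has `F(0) = f` and `F(-α_s) = s f`, and `∂_s f` is
the value at `T = -α_s` of the polynomial `(F(T) - F(0)) / T`. It is the `k`-linear operator
which is `α_s^∨` on `V` and obeys the twisted Leibniz rule: see `demazureSimple_ι` and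
`demazureSimple_mul`. -/
def demazureSimple (s : B) : Module.End k R.Poly where
  toFun f := ((R.shift s f).divX).eval (-SymmetricAlgebra.ι k V (R.root s))
  map_add' f g := by simp [Polynomial.divX_add]
  map_smul' c f := by
    have h : (c • R.shift s f).divX = c • (R.shift s f).divX := by
      ext n; simp [Polynomial.coeff_divX]
    simp [h, Polynomial.eval_smul]

theorem shift_ι (s : B) (v : V) : R.shift s (SymmetricAlgebra.ι k V v) =
    Polynomial.C (SymmetricAlgebra.ι k V v) + R.coroot s v • Polynomial.X := by
  simp [shift]

theorem demazureSimple_ι (s : B) (v : V) :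
    R.demazureSimple s (SymmetricAlgebra.ι k V v) = algebraMap k R.Poly (R.coroot s v) := by
  have h : (R.shift s (SymmetricAlgebra.ι k V v)).divX
      = Polynomial.C (algebraMap k R.Poly (R.coroot s v)) := by
    ext n
    rw [Polynomial.coeff_divX, shift_ι]
    rcases n with _ | n <;> simp [Polynomial.coeff_C, Algebra.smul_def]
  simp [demazureSimple, h]

theorem shift_coeff_zero (s : B) (f : R.Poly) : (R.shift s f).coeff 0 = f := by
  have h : ((Polynomial.aeval (0 : R.Poly)).restrictScalars k).comp (R.shift s)
      = AlgHom.id k R.Poly := by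
    apply SymmetricAlgebra.algHom_ext
    ext v
    simp [shift_ι]
  have := DFunLike.congr_fun h f
  simpa [Polynomial.coeff_zero_eq_eval_zero, Polynomial.aeval_def] using this

theorem shift_eval (s : B) (f : R.Poly) :
    (R.shift s f).eval (-SymmetricAlgebra.ι k V (R.root s)) = R.act (cs.simple s) f := by
  have h : ((Polynomial.aeval (-SymmetricAlgebra.ι k V (R.root s))).restrictScalars k).comp
      (R.shift s) = R.act (cs.simple s) := by
    apply SymmetricAlgebra.algHom_ext
    ext v
    simp [shift_ι, act, rep_simple, reflectionMap_apply, sub_eq_add_neg]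
  have := DFunLike.congr_fun h f
  simpa [Polynomial.aeval_def] using this

/-- `α_s ∂_s(f) = f - s(f)`. -/
theorem root_mul_demazureSimple (s : B) (f : R.Poly) :
    SymmetricAlgebra.ι k V (R.root s) * R.demazureSimple s f = f - R.act (cs.simple s) f := by
  have h := congrArg (Polynomial.eval (-SymmetricAlgebra.ι k V (R.root s)))
    (Polynomial.divX_mul_X_add (R.shift s f))
  simp only [Polynomial.eval_add, Polynomial.eval_mul, Polynomial.eval_X, Polynomial.eval_C,
    shift_coeff_zero, shift_eval] at h
  simp only [demazureSimple, LinearMap.coe_mk, AddHom.coe_mk]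
  rw [← h]; ring

/-- The twisted Leibniz rule `∂_s(fg) = s(f) ∂_s(g) + ∂_s(f) g`. -/
theorem demazureSimple_mul (s : B) (f g : R.Poly) : R.demazureSimple s (f * g) =
    R.act (cs.simple s) f * R.demazureSimple s g + R.demazureSimple s f * g := by
  have h : (R.shift s (f * g)).divX
      = R.shift s f * (R.shift s g).divX + (R.shift s f).divX * Polynomial.C g := by
    have hX : ∀ p q : Polynomial R.Poly, Polynomial.X * p = Polynomial.X * q → p = q := by
      intro p q hpq
      ext n
      simpa using congrArg (fun r => Polynomial.coeff r (n + 1)) hpq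
    apply hX
    have e := fun f : R.Poly => Polynomial.X_mul_divX_add (R.shift s f)
    simp only [shift_coeff_zero] at e
    have e0 := e (f * g)
    rw [map_mul, map_mul] at e0
    rw [map_mul]
    linear_combination e0 - R.shift s f * e g - Polynomial.C g * e f
  simp only [demazureSimple, LinearMap.coe_mk, AddHom.coe_mk, h, Polynomial.eval_add,
    Polynomial.eval_mul, Polynomial.eval_C, shift_eval]

/-- A reduced word for `w`, chosen once and for all, independently of the realization. -/
def reducedWord (cs : CoxeterSystem m W) (w : W) : List B :=
  Classical.choose (cs.exists_isReduced w)

/-- The Demazure operator `∂_w`, the composition of the operators `∂_s` along a reduced word for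
`w`. For a balanced realization the Demazure operators satisfy the braid relations, so the choice
of the reduced word does not matter. -/
def demazure (w : W) : Module.End k R.Poly :=
  ((reducedWord cs w).map R.demazureSimple).prod

/-- The Demazure operator `∂_q = ∂_{max(q) w_J⁻¹}` of an `(I,J)`-coset, as an operator on the whole
polynomial ring. -/
def demazureCoset {I J : Set B} (q : Coset cs I J) : Module.End k R.Poly :=
  R.demazure (q.max * (longestElement cs J)⁻¹)

/-- The Frobenius trace `∂^K_I : R^K → R^I` for `K ⊆ I`: the Demazure operator of the `(I,K)`-coset
`W_I`, whose maximal element is `w_I`. -/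
def frobeniusTrace (K I : Set B) : Module.End k R.Poly :=
  R.demazureCoset (Coset.of cs I K 1)

/-- A realization is balanced if the quantum numbers `[m_st - 1]` equal `1`. -/
def Balanced : Prop :=
  ∀ s t, s ≠ t → m s t ≠ 0 →
    quantumNumber (m s t - 1) (-R.coroot s (R.root t)) (-R.coroot t (R.root s)) = 1

/-- Generalized Demazure surjectivity: `α_s : V* → k` and `α_s^∨ : V → k` are surjective, and for
each finitary `I` the operator `∂_{w_I}` maps `R` onto `R^I`. -/
structure GeneralizedDemazureSurjective : Prop where
  root_surjective : ∀ s, Function.Surjective fun φ : Module.Dual k V => φ (R.root s)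
  coroot_surjective : ∀ s, Function.Surjective (R.coroot s)
  onto : ∀ I, Finitary cs I →
    Set.range (R.demazure (longestElement cs I)) = (R.invariants I : Set R.Poly)

/-- A (balanced) Frobenius realization. -/
structure IsFrobenius : Prop where
  balanced : R.Balanced
  surjective : R.GeneralizedDemazureSurjective
  faithful : ∀ I, Finitary cs I → ∀ w ∈ parabolic cs I, R.rep w = 1 → w = 1

/-- The rightward atomic Leibniz rule for the atomic coset of the datum `d`. -/
def RightwardRule (d : AtomicDatum cs) : Prop :=
  ∃ T : ∀ q : {q : Coset cs d.I d.J // q.Lt d.coset},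
      R.invariantsOver d.J_subset →ₗ[R.invariants d.M] R.invariantsOver (d.rightRed_subset q.1),
    ∀ f g : R.invariantsOver d.J_subset,
      R.demazureCoset d.coset (f * g : R.Poly) =
        R.act d.coset.min (f : R.Poly) * R.demazureCoset d.coset (g : R.Poly) +
          ∑ᶠ q, R.demazure (q.1.max * (longestElement cs d.J)⁻¹) ((T q f : R.Poly) * (g : R.Poly))

/-- The leftward atomic Leibniz rule for the atomic coset of the datum `d`. -/
def LeftwardRule (d : AtomicDatum cs) : Prop :=
  ∃ T : ∀ q : {q : Coset cs d.I d.J // q.Lt d.coset},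
      R.invariantsOver d.J_subset →ₗ[R.invariants d.M] R.invariantsOver (d.leftRed_subset q.1),
    ∀ f g : R.invariantsOver d.J_subset,
      R.demazureCoset d.coset (f * g : R.Poly) =
        R.act d.coset.min (f : R.Poly) * R.demazureCoset d.coset (g : R.Poly) +
          ∑ᶠ q, R.frobeniusTrace q.1.leftRed d.I
            ((T q f : R.Poly) * R.demazureCoset q.1.core (g : R.Poly))

/-! ### Changing the realization -/

/-- The Coxeter relations pass along a surjective map that intertwines two families of
endomorphisms. -/
theorem liftable_of_comp {V' : Type*} [AddCommGroup V'] [Module k V']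
    {r : B → Module.End k V} {r' : B → Module.End k V'} (p : V →ₗ[k] V')
    (hp : Function.Surjective p) (h : ∀ s v, p (r s v) = r' s (p v)) (hr : m.IsLiftable r) :
    m.IsLiftable r' := by
  intro i j
  have key : ∀ n v, p (((r i * r j) ^ n) v) = ((r' i * r' j) ^ n) (p v) := by
    intro n
    induction n with
    | zero => simp
    | succ n ih => intro v; simp [pow_succ, ih, h]
  ext v'
  obtain ⟨v, rfl⟩ := hp v'
  rw [← key, hr i j]
  simp

/-- The specialization (base change) along `k → k'`. The new coroots are the `k'`-linear
extensions of the old ones. -/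
def specialization (k' : Type uk') [CommRing k'] [Algebra k k'] :
    Realization cs k' (k' ⊗[k] V) where
  free := by have := R.free; infer_instance
  finite := by have := R.finite; infer_instance
  root s := 1 ⊗ₜ R.root s
  coroot s := (R.coroot s).baseChange k'
  coroot_root s := by simp [R.coroot_root, Algebra.smul_def, map_ofNat]
  liftable := by
    have h : ∀ s, reflectionMap (k := k') (V := k' ⊗[k] V) (1 ⊗ₜ R.root s)
        ((R.coroot s).baseChange k')
        = (reflectionMap (R.root s) (R.coroot s)).baseChange k' := by
      intro s
      ext v
      simp [reflectionMap_apply, TensorProduct.tmul_sub, TensorProduct.smul_tmul']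
    intro i j
    simp only [h]
    rw [← LinearMap.baseChange_mul, ← LinearMap.baseChange_pow, R.liftable i j,
      LinearMap.baseChange_one]
  technical s t hst := by
    have h := congrArg (algebraMap k k') (R.technical s t hst)
    rw [map_quantumNumber] at h
    simpa [Algebra.smul_def] using h

/-- The `W`-invariant enlargement by a free module `N` of finite rank with trivial action. -/
def enlargement (N : Type uN) [AddCommGroup N] [Module k N] [Module.Free k N]
    [Module.Finite k N] : Realization cs k (V × N) where
  free := by have := R.free; infer_instance
  finite := by have := R.finite; infer_instance
  root s := (R.root s, 0)
  coroot s := R.coroot s ∘ₗ LinearMap.fst k V N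
  coroot_root s := by simp [R.coroot_root]
  liftable := by
    have h : ∀ s, reflectionMap (k := k) (V := V × N) (R.root s, 0)
        (R.coroot s ∘ₗ LinearMap.fst k V N)
        = (reflectionMap (R.root s) (R.coroot s)).prodMap LinearMap.id := by
      intro s
      ext v <;> simp [reflectionMap_apply]
    intro i j
    simp only [h]
    have key : ∀ n : ℕ, ((reflectionMap (R.root i) (R.coroot i)).prodMap
        (LinearMap.id : N →ₗ[k] N) * (reflectionMap (R.root j) (R.coroot j)).prodMap
        LinearMap.id : Module.End k (V × N)) ^ n =
        LinearMap.prodMap ((reflectionMap (R.root i) (R.coroot i) *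
          reflectionMap (R.root j) (R.coroot j)) ^ n) LinearMap.id := by
      intro n
      induction n with
      | zero => ext v <;> simp
      | succ n ih => rw [pow_succ, ih]; ext v <;> simp [pow_succ]
    rw [key, R.liftable i j]
    ext v <;> simp
  technical s t hst := by simpa using R.technical s t hst

/-- The data for a `W`-invariant quotient: a decomposition `V = X ⊕ Y` into free modules, such that
`W` acts trivially on `X`, and such that the image of each `α_s` in `Y ≅ V / X` induces a surjection
`Y* → k`. -/
structure QuotientDatum where
  X : Submodule k V
  Y : Submodule k V
  isCompl : IsCompl X Y
  freeX : Module.Free k X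
  freeY : Module.Free k Y
  trivial : ∀ w : W, ∀ x ∈ X, R.rep w x = x
  surjective : ∀ s : B, Function.Surjective fun φ : Module.Dual k Y =>
    φ (Y.projectionOnto X isCompl.symm (R.root s))

variable {R}

/-- The projection `V → Y` along `X`. -/
def QuotientDatum.proj (D : R.QuotientDatum) : V →ₗ[k] D.Y :=
  D.Y.projectionOnto D.X D.isCompl.symm

theorem QuotientDatum.coroot_eq_zero (D : R.QuotientDatum) (s : B) {x : V} (hx : x ∈ D.X) :
    R.coroot s x = 0 := by
  have h := D.trivial (cs.simple s) x hx
  rw [rep_simple, reflectionMap_apply, sub_eq_self] at h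
  obtain ⟨φ, hφ⟩ := D.surjective s 1
  have h' := congrArg (fun v => φ (D.proj v)) h
  simp only [map_smul, map_zero, smul_eq_mul] at h'
  have hφ' : φ (D.proj (R.root s)) = 1 := hφ
  rwa [hφ', mul_one] at h'

theorem QuotientDatum.coroot_proj (D : R.QuotientDatum) (s : B) (v : V) :
    R.coroot s (D.proj v : V) = R.coroot s v := by
  have h : v - (D.proj v : V) ∈ D.X := by
    have : D.proj (v - (D.proj v : V)) = 0 := by
      rw [map_sub, sub_eq_zero]
      exact (Submodule.projectionOnto_apply_left D.isCompl.symm (D.proj v)).symm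
    exact (Submodule.projectionOnto_apply_eq_zero_iff D.isCompl.symm).1 this
  have := D.coroot_eq_zero s h
  rw [map_sub, sub_eq_zero] at this
  exact this.symm

/-- The `W`-invariant quotient `Y ≅ V / X`: the roots are the images of the old roots under the
projection along `X`, and the coroots are those induced by the old ones, which kill `X`. -/
def quotient (D : R.QuotientDatum) : Realization cs k D.Y where
  free := D.freeY
  finite := by
    have := R.finite
    exact Module.Finite.of_surjective D.proj
      (Submodule.projectionOnto_surjective D.isCompl.symm)
  root s := D.proj (R.root s)
  coroot s := R.coroot s ∘ₗ D.Y.subtype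
  coroot_root s := by simpa [D.coroot_proj] using R.coroot_root s
  liftable := by
    refine liftable_of_comp D.proj (Submodule.projectionOnto_surjective D.isCompl.symm) ?_
      R.liftable
    intro s v
    simp [reflectionMap_apply, D.coroot_proj]
  technical s t hst := by simpa [D.coroot_proj] using R.technical s t hst

end Realization

end Realization

end AtomicLeibniz

end

/-!
Demazure operators commute with extension of scalars to a ring `A` of `W`-invariant elements: they
are divided differences, and the roots stay regular because some functional takes the value `1` on
each of them. If `∂_{w_J}(P) = 1`, then `f ↦ ∂_{w_J}(f P)` is an `R^J`-linear projection of `R` onto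
`R^J`. Two consequences make a Leibniz rule extend. After the extension the ring of
`W_J`-invariants is still generated by `A` and `R^J`, and the `R^M`-linear maps `T_q` can be
continued to all of `R`, where they extend along with the scalars.

Specializations and enlargements extend scalars along `k → k'` and `k → Sym N`. For a quotient by
`X`, the map `Sym V → Sym (V / X)` is the base change along `Sym X → k`: since `W` fixes `X`, any
`R^M`-linear operator is linear over `Sym X` and therefore descends.
-/

universe uV'

noncomputable section

namespace AtomicLeibniz

section Inversions

variable {B : Type uB} {W : Type uW} [Group W] {m : CoxeterMatrix B} (cs : CoxeterSystem m W)

open Classical in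
/-- The conjugation `t ↦ s_i t s_i` together with a flip of the sign when `t = s_i`. These maps
satisfy the Coxeter relations, and along a word they count the occurrences of `t` in its inversion
sequence modulo `2`. -/
def signedConj (i : B) : Function.End (W × ZMod 2) := fun p =>
  (cs.simple i * p.1 * cs.simple i, p.2 + if p.1 = cs.simple i then 1 else 0)

open Classical in
theorem signedConj_smul (i : B) (t : W) (ε : ZMod 2) : signedConj cs i • (t, ε) =
    (cs.simple i * t * cs.simple i, ε + if t = cs.simple i then 1 else 0) := rfl

theorem conj_pow_eq_mul_pow_iff {G : Type*} [Group G] {s x : G} (h : SemiconjBy s x x⁻¹) (n e : ℕ)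
    (t : G) : x ^ n * t * (x ^ n)⁻¹ = s * x ^ e ↔ t = s * x ^ (2 * n + e) := by
  have hpow := (h.pow_right n).eq
  rw [mul_inv_eq_iff_eq_mul, ← eq_inv_mul_iff_mul_eq, ← inv_pow, mul_assoc, ← mul_assoc, ← hpow,
    mul_assoc, ← pow_add, ← pow_add]
  congr! 3
  ring

open Classical in
theorem signedConj_mul_pow_smul (i j : B) (n : ℕ) (t : W) (ε : ZMod 2) :
    (signedConj cs i * signedConj cs j) ^ n • (t, ε) =
      ((cs.simple i * cs.simple j) ^ n * t * ((cs.simple i * cs.simple j) ^ n)⁻¹,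
        ε + ∑ e ∈ Finset.range (2 * n),
          if t = cs.simple j * (cs.simple i * cs.simple j) ^ e then 1 else 0) := by
  induction n with
  | zero => simp
  | succ n ih =>
    have hconj : SemiconjBy (cs.simple j) (cs.simple i * cs.simple j)
        (cs.simple i * cs.simple j)⁻¹ := by
      simp [SemiconjBy, mul_assoc]
    have hsj (u : W) : u = cs.simple j ↔
        u = cs.simple j * (cs.simple i * cs.simple j) ^ 0 := by
      rw [pow_zero, mul_one]
    have hsi (u : W) : cs.simple j * u * cs.simple j = cs.simple i ↔
        u = cs.simple j * (cs.simple i * cs.simple j) ^ 1 := by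
      rw [pow_one, ← eq_mul_inv_iff_mul_eq, ← eq_inv_mul_iff_mul_eq, cs.inv_simple]
    rw [pow_succ' _ n, mul_smul, ih, mul_smul, signedConj_smul, signedConj_smul]
    simp only [hsi, hsj, conj_pow_eq_mul_pow_iff hconj]
    simp only [mul_add_one, Finset.sum_range_succ, add_zero, add_assoc, pow_succ' _ n, mul_inv_rev,
      cs.inv_simple, mul_assoc]

theorem signedConj_isLiftable : m.IsLiftable (signedConj cs) := by
  classical
  intro i j
  refine eq_of_smul_eq_smul fun p : W × ZMod 2 => ?_
  obtain ⟨t, ε⟩ := p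
  rw [signedConj_mul_pow_smul, two_mul, Finset.sum_range_add]
  simp [pow_add, CharTwo.add_self_eq_zero]

/-- The representation of `W` on `W × {±1}` given on generators by `signedConj`. -/
def signedConjRep : W →* Function.End (W × ZMod 2) :=
  cs.lift ⟨signedConj cs, signedConj_isLiftable cs⟩

open Classical in
theorem signedConjRep_wordProd_smul (ω : List B) (t : W) (ε : ZMod 2) :
    signedConjRep cs (cs.wordProd ω) • (t, ε) =
      (cs.wordProd ω * t * (cs.wordProd ω)⁻¹, ε + ((cs.rightInvSeq ω).count t : ZMod 2)) := by
  induction ω with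
  | nil => simp
  | cons i ω ih =>
    have hsimple : signedConjRep cs (cs.simple i) = signedConj cs i :=
      cs.lift_apply_simple (signedConj_isLiftable cs) i
    have hconj : cs.wordProd ω * t * (cs.wordProd ω)⁻¹ = cs.simple i ↔
        (cs.wordProd ω)⁻¹ * cs.simple i * cs.wordProd ω = t := by
      rw [mul_inv_eq_iff_eq_mul, ← eq_inv_mul_iff_mul_eq, mul_assoc, eq_comm]
    rw [cs.wordProd_cons, map_mul, mul_smul, ih, hsimple, signedConj_smul]
    simp only [hconj]
    simp only [CoxeterSystem.rightInvSeq, List.count_cons, beq_iff_eq, Nat.cast_add,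
      Nat.cast_ite, Nat.cast_one, Nat.cast_zero, mul_inv_rev, cs.inv_simple, mul_assoc, add_assoc]

variable {cs}

theorem mem_rightInvSeq_of_isReduced {ω ω' : List B} (hω : cs.IsReduced ω)
    (h : cs.wordProd ω = cs.wordProd ω') {t : W} (ht : t ∈ cs.rightInvSeq ω) :
    t ∈ cs.rightInvSeq ω' := by
  classical
  have hcount : ((cs.rightInvSeq ω).count t : ZMod 2) = (cs.rightInvSeq ω').count t := by
    have hω := signedConjRep_wordProd_smul cs ω t 0
    rw [h, signedConjRep_wordProd_smul] at hω
    simpa using (congrArg Prod.snd hω).symm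
  rw [List.count_eq_one_of_mem hω.nodup_rightInvSeq ht] at hcount
  by_contra ht'
  simp [List.count_eq_zero_of_not_mem ht'] at hcount

theorem wordProd_mem {H : Subgroup W} {ω : List B} (hω : ∀ i ∈ ω, cs.simple i ∈ H) :
    cs.wordProd ω ∈ H :=
  H.list_prod_mem (by simpa using hω)

theorem forall_mem_rightInvSeq_iff {H : Subgroup W} {ω : List B} :
    (∀ t ∈ cs.rightInvSeq ω, t ∈ H) ↔ ∀ i ∈ ω, cs.simple i ∈ H := by
  induction ω with
  | nil => simp
  | cons i ω ih =>
    simp only [CoxeterSystem.rightInvSeq, List.forall_mem_cons, ih]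
    refine and_congr_left fun hω => ?_
    have hprod := wordProd_mem hω
    rw [mul_mem_cancel_right hprod, mul_mem_cancel_left (inv_mem hprod)]

theorem exists_word_of_mem_parabolic {I : Set B} {w : W} (hw : w ∈ parabolic cs I) :
    ∃ ω : List B, (∀ i ∈ ω, i ∈ I) ∧ cs.wordProd ω = w := by
  induction hw using Subgroup.closure_induction_left with
  | one => exact ⟨[], by simp⟩
  | mul_left x hx w _ ih | inv_mul_cancel x hx w _ ih =>
    obtain ⟨i, hi, rfl⟩ := hx
    obtain ⟨ω, hω, rfl⟩ := ih
    exact ⟨i :: ω, by simpa [hi] using hω, by simp [cs.wordProd_cons]⟩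

theorem simple_mem_parabolic {I : Set B} {i : B} (hi : i ∈ I) : cs.simple i ∈ parabolic cs I :=
  Subgroup.subset_closure ⟨i, hi, rfl⟩

theorem parabolic_mono {I J : Set B} (h : I ⊆ J) : parabolic cs I ≤ parabolic cs J :=
  Subgroup.closure_mono (Set.image_mono h)

theorem simple_mem_parabolic_of_isReduced {I : Set B} {ω : List B} (hω : cs.IsReduced ω)
    (hw : cs.wordProd ω ∈ parabolic cs I) : ∀ i ∈ ω, cs.simple i ∈ parabolic cs I := by
  obtain ⟨ω', hω', hprod⟩ := exists_word_of_mem_parabolic hw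
  have hinv : ∀ t ∈ cs.rightInvSeq ω', t ∈ parabolic cs I :=
    forall_mem_rightInvSeq_iff.2 fun i hi => simple_mem_parabolic (hω' i hi)
  exact forall_mem_rightInvSeq_iff.1 fun t ht =>
    hinv t (mem_rightInvSeq_of_isReduced hω hprod.symm ht)

theorem longestElement_mem {I : Set B} (hI : Finitary cs I) :
    longestElement cs I ∈ parabolic cs I :=
  (longest_spec cs ⟨1, one_mem (parabolic cs I)⟩ (Set.finite_coe_iff.1 hI)).1

theorem Finitary.mono {I J : Set B} (hJ : Finitary cs J) (h : I ⊆ J) : Finitary cs I :=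
  (Set.finite_coe_iff.1 hJ).subset (parabolic_mono h)

end Inversions

section SymmetricAlgebra

open SymmetricAlgebra

theorem isRegular_ι_of_dual_eq_one {k : Type*} {V : Type*} [CommRing k] [AddCommMonoid V]
    [Module k V] {v : V} (φ : Module.Dual k V) (hφ : φ v = 1) : IsRegular (ι k V v) := by
  let shift : SymmetricAlgebra k V →ₐ[k] Polynomial (SymmetricAlgebra k V) :=
    lift (Polynomial.CAlgHom.toLinearMap ∘ₗ ι k V + φ.smulRight Polynomial.X)
  have hshift : shift (ι k V v) = Polynomial.X + Polynomial.C (ι k V v) := by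
    simp [shift, hφ, add_comm]
  have hinv : ((Polynomial.aeval 0).restrictScalars k).comp shift =
      AlgHom.id k (SymmetricAlgebra k V) := by
    apply SymmetricAlgebra.algHom_ext
    ext u
    simp [shift]
  have hinj : Function.Injective shift :=
    Function.LeftInverse.injective (DFunLike.congr_fun hinv)
  refine isLeftRegular_iff_isRegular.1 fun x y hxy => hinj ?_
  apply (Polynomial.monic_X_add_C (ι k V v)).isRegular.left
  simpa [hshift] using congrArg shift hxy

variable {k : Type*} {V : Type*} [CommRing k] [AddCommGroup V] [Module k V]
variable {k' : Type*} {V' : Type*} [CommRing k'] [AddCommGroup V'] [Module k' V']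
variable [Algebra k k'] [Module k V'] [IsScalarTower k k' V']

/-- The ring map `Sym_k V → Sym_k' V'` induced by a `k`-linear map `V → V'`, where `k'` is a
`k`-algebra and `V'` a `k'`-module. -/
def polyMap (p : V →ₗ[k] V') : SymmetricAlgebra k V →ₐ[k] SymmetricAlgebra k' V' :=
  lift ((ι k' V').restrictScalars k ∘ₗ p)

theorem polyMap_ι (p : V →ₗ[k] V') (v : V) : polyMap p (ι k V v) = ι k' V' (p v) := by
  simp [polyMap]

theorem eq_top_of_algebraMap_mem_of_ι_mem {S : Subalgebra k (SymmetricAlgebra k' V')}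
    (hscalar : ∀ c, algebraMap k' _ c ∈ S) (hι : ∀ v, ι k' V' v ∈ S) : S = ⊤ := by
  refine Algebra.eq_top_iff.2 fun f => ?_
  induction f using SymmetricAlgebra.induction with
  | algebraMap c => exact hscalar c
  | ι v => exact hι v
  | mul f g hf hg => exact mul_mem hf hg
  | add f g hf hg => exact add_mem hf hg

end SymmetricAlgebra

theorem subalgebra_sup_induction {k A : Type*} [CommSemiring k] [CommSemiring A] [Algebra k A]
    {S T : Subalgebra k A} {motive : A → Prop} (mul : ∀ a ∈ S, ∀ b ∈ T, motive (a * b))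
    (add : ∀ x y, motive x → motive y → motive (x + y)) {x : A} (hx : x ∈ S ⊔ T) : motive x := by
  rw [← Subalgebra.mem_toSubmodule, ← Subalgebra.mul_toSubmodule] at hx
  exact Submodule.mul_induction_on hx mul add

/-- The operator `F'` on `P'` restricts to the `A`-linear extension of the operator `F` on `P`,
where `P'` is regarded as an algebra over `A` through `j` and over `P` through `φ`. -/
def ExtendsAlong {k A P P' : Type*} [CommSemiring k] [Semiring A] [Semiring P] [Semiring P']
    [Algebra k A] [Algebra k P] [Algebra k P'] (j : A →ₐ[k] P') (φ : P →ₐ[k] P') (F : P → P)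
    (F' : P' → P') : Prop :=
  ∀ a f, F' (j a * φ f) = j a * φ (F f)

theorem exists_extendsAlong_of_tensor {k A P P' : Type*} [CommSemiring k] [CommSemiring A]
    [CommSemiring P] [CommSemiring P'] [Algebra k A] [Algebra k P] [Algebra k P'] {j : A →ₐ[k] P'}
    {φ : P →ₐ[k] P'} (τ : P' →ₐ[k] A ⊗[k] P) (hj : ∀ a, τ (j a) = a ⊗ₜ 1)
    (hφ : ∀ f, τ (φ f) = 1 ⊗ₜ f) (θ : P →ₗ[k] P) : ∃ θ' : P' →ₗ[k] P', ExtendsAlong j φ θ θ' :=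
  ⟨(Algebra.TensorProduct.productMap j φ).toLinearMap ∘ₗ θ.lTensor A ∘ₗ τ.toLinearMap,
    fun a f => by simp [hj, hφ]⟩

namespace Realization

open SymmetricAlgebra

section Demazure

variable {B : Type uB} {W : Type uW} [Group W] {m : CoxeterMatrix B} {cs : CoxeterSystem m W}
variable {k : Type uk} {V : Type uV} [CommRing k] [AddCommGroup V] [Module k V]
variable (R : Realization cs k V)

theorem act_ι (w : W) (v : V) : R.act w (ι k V v) = ι k V (R.rep w v) := by
  simp [act]

theorem act_one : R.act 1 = AlgHom.id k R.Poly := by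
  apply SymmetricAlgebra.algHom_ext
  ext v
  simp [act_ι]

theorem act_mul (w w' : W) : R.act (w * w') = (R.act w).comp (R.act w') := by
  apply SymmetricAlgebra.algHom_ext
  ext v
  simp [act_ι]

theorem demazureSimple_algebraMap (s : B) (c : k) : R.demazureSimple s (algebraMap k _ c) = 0 := by
  have hone : R.demazureSimple s 1 = 0 := by simpa using R.demazureSimple_mul s 1 1
  rw [Algebra.algebraMap_eq_smul_one, map_smul, hone, smul_zero]

/-- The roots are regular elements of the polynomial ring, so that `∂_s` is determined by
`α_s ∂_s(f) = f - s(f)`. -/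
def RootsRegular : Prop := ∀ s, IsRegular (ι k V (R.root s))

variable {R}

theorem RootsRegular.demazureSimple_eq_zero (hR : R.RootsRegular) {s : B} {f : R.Poly}
    (hf : R.act (cs.simple s) f = f) : R.demazureSimple s f = 0 :=
  (hR s).left.mul_left_eq_zero_iff.1 <| by rw [root_mul_demazureSimple, hf, sub_self]

theorem RootsRegular.demazureSimple_mul (hR : R.RootsRegular) {s : B} {f : R.Poly}
    (hf : R.act (cs.simple s) f = f) (g : R.Poly) :
    R.demazureSimple s (f * g) = f * R.demazureSimple s g := by
  rw [Realization.demazureSimple_mul, hf, hR.demazureSimple_eq_zero hf, zero_mul, add_zero]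

theorem RootsRegular.prod_demazureSimple_mul (hR : R.RootsRegular) {ω : List B} {f : R.Poly}
    (hf : ∀ i ∈ ω, R.act (cs.simple i) f = f) (g : R.Poly) :
    (ω.map R.demazureSimple).prod (f * g) = f * (ω.map R.demazureSimple).prod g := by
  induction ω with
  | nil => simp
  | cons i ω ih =>
    rw [List.forall_mem_cons] at hf
    rw [List.map_cons, List.prod_cons, Module.End.mul_apply, Module.End.mul_apply, ih hf.2,
      hR.demazureSimple_mul hf.1]

theorem RootsRegular.demazure_mul (hR : R.RootsRegular) {I : Set B} {w : W}
    (hw : w ∈ parabolic cs I) {f : R.Poly} (hf : f ∈ R.invariants I) (g : R.Poly) :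
    R.demazure w (f * g) = f * R.demazure w g := by
  obtain ⟨hreduced, hprod⟩ := Classical.choose_spec (cs.exists_isReduced w)
  exact hR.prod_demazureSimple_mul
    (fun i hi => hf _ (simple_mem_parabolic_of_isReduced hreduced (hprod ▸ hw) i hi)) g

theorem invariants_mono {I M : Set B} (h : I ⊆ M) : R.invariants M ≤ R.invariants I :=
  fun _ hf w hw => hf w (parabolic_mono h hw)

namespace GeneralizedDemazureSurjective

variable (hR : R.GeneralizedDemazureSurjective)
include hR

theorem rootsRegular : R.RootsRegular := fun s =>
  let ⟨φ, hφ⟩ := hR.root_surjective s 1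
  isRegular_ι_of_dual_eq_one φ hφ

theorem demazure_longestElement_mem {I : Set B} (hI : Finitary cs I) (f : R.Poly) :
    R.demazure (longestElement cs I) f ∈ R.invariants I :=
  (hR.onto I hI).subset ⟨f, rfl⟩

theorem exists_demazure_longestElement_eq_one {I : Set B} (hI : Finitary cs I) :
    ∃ P, R.demazure (longestElement cs I) P = 1 :=
  (hR.onto I hI).superset (one_mem (R.invariants I))

theorem exists_retraction {I M : Set B} (hIM : I ⊆ M) (hI : Finitary cs I) :
    ∃ π : R.Poly →ₗ[R.invariants M] R.invariantsOver hIM,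
      π ∘ₗ (R.invariantsOver hIM).subtype = LinearMap.id := by
  obtain ⟨P, hP⟩ := hR.exists_demazure_longestElement_eq_one hI
  have hlinear {f : R.Poly} (hf : f ∈ R.invariants I) (g : R.Poly) :
      R.demazure (longestElement cs I) (f * g) = f * R.demazure (longestElement cs I) g :=
    hR.rootsRegular.demazure_mul (longestElement_mem hI) hf g
  let π : R.Poly →ₗ[R.invariants M] R.Poly :=
    { toFun := fun f => R.demazure (longestElement cs I) (f * P)
      map_add' := fun f g => by rw [add_mul, map_add]
      map_smul' := fun c f => by
        rw [Algebra.smul_mul_assoc]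
        exact hlinear (invariants_mono hIM c.2) (f * P) }
  refine ⟨π.codRestrict _ fun f => hR.demazure_longestElement_mem hI _, ?_⟩
  refine LinearMap.ext fun f => Subtype.ext ?_
  change R.demazure (longestElement cs I) (f * P) = f
  rw [hlinear f.2, hP, mul_one]

end GeneralizedDemazureSurjective

end Demazure

section Hom

variable {B : Type uB} {W : Type uW} [Group W] {m : CoxeterMatrix B} {cs : CoxeterSystem m W}
variable {k : Type uk} {V : Type uV} [CommRing k] [AddCommGroup V] [Module k V]
variable {k' : Type uk'} {V' : Type uV'} [CommRing k'] [AddCommGroup V'] [Module k' V']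
variable [Algebra k k'] [Module k V'] [IsScalarTower k k' V']

/-- A morphism from a realization over `k` to a realization over a `k`-algebra `k'`: a `k`-linear
map that is compatible with roots and coroots. -/
structure IsHom (R : Realization cs k V) (R' : Realization cs k' V') (p : V →ₗ[k] V') : Prop where
  map_root : ∀ s, p (R.root s) = R'.root s
  coroot_map : ∀ s v, R'.coroot s (p v) = algebraMap k k' (R.coroot s v)

namespace IsHom

variable {R : Realization cs k V} {R' : Realization cs k' V'} {p : V →ₗ[k] V'}
variable (h : IsHom R R' p)
include h

theorem map_rep (w : W) (v : V) : p (R.rep w v) = R'.rep w (p v) := by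
  induction w using cs.simple_induction generalizing v with
  | simple s =>
    simp only [rep_simple, reflectionMap_apply, map_sub, map_smul, h.map_root, h.coroot_map,
      algebraMap_smul]
  | one => simp
  | mul w w' hw hw' => simp [hw, hw']

theorem polyMap_act (w : W) (f : R.Poly) : polyMap p (R.act w f) = R'.act w (polyMap p f) := by
  have hcomp : (polyMap p).comp (R.act w) = ((R'.act w).restrictScalars k).comp (polyMap p) := by
    apply SymmetricAlgebra.algHom_ext
    ext v
    simp [act_ι, polyMap_ι, h.map_rep]
  exact DFunLike.congr_fun hcomp f

theorem polyMap_mem_invariants {I : Set B} {f : R.Poly} (hf : f ∈ R.invariants I) :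
    polyMap p f ∈ R'.invariants I :=
  fun w hw => by rw [← h.polyMap_act, hf w hw]

theorem polyMap_demazureSimple (s : B) (f : R.Poly) :
    polyMap p (R.demazureSimple s f) = R'.demazureSimple s (polyMap p f) := by
  induction f using SymmetricAlgebra.induction with
  | algebraMap c =>
    rw [demazureSimple_algebraMap, map_zero, AlgHom.commutes,
      IsScalarTower.algebraMap_apply k k' R'.Poly, demazureSimple_algebraMap]
  | ι v =>
    rw [demazureSimple_ι, polyMap_ι, demazureSimple_ι, h.coroot_map, AlgHom.commutes,
      IsScalarTower.algebraMap_apply k k' R'.Poly]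
  | mul f g hf hg =>
    rw [demazureSimple_mul, map_add, map_mul, map_mul, h.polyMap_act, hf, hg, map_mul,
      demazureSimple_mul]
  | add f g hf hg => simp only [map_add, hf, hg]

end IsHom

end Hom

section ScalarExtension

variable {B : Type uB} {W : Type uW} [Group W] {m : CoxeterMatrix B} {cs : CoxeterSystem m W}
variable {k : Type uk} {V : Type uV} [CommRing k] [AddCommGroup V] [Module k V]
variable {k' : Type uk'} {V' : Type uV'} [CommRing k'] [AddCommGroup V'] [Module k' V']
variable [Algebra k k'] [Module k V'] [IsScalarTower k k' V']
variable {A : Type*} [CommRing A] [Algebra k A]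

/-- The realization `R'` arises from `R` by extending scalars to a ring `A` of `W`-invariant
elements: the polynomial ring of `R'` is generated by `A` and the image of that of `R`, and
operators on `R.Poly` that are linear over some ring of invariants extend `A`-linearly. -/
structure IsScalarExtension (R : Realization cs k V) (R' : Realization cs k' V')
    (j : A →ₐ[k] R'.Poly) (p : V →ₗ[k] V') : Prop extends IsHom R R' p where
  rootsRegular : R'.RootsRegular
  act_simple_scalar : ∀ s a, R'.act (cs.simple s) (j a) = j a
  range_sup_range : j.range ⊔ (polyMap p).range = ⊤
  exists_extendsAlong : ∀ {M : Set B} (θ : R.Poly →ₗ[R.invariants M] R.Poly),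
    ∃ θ' : R'.Poly →ₗ[k] R'.Poly, ExtendsAlong j (polyMap p) θ θ'

/-- A twisted Leibniz rule `D (f g) = w(f) D(g) + ∑_q E_q (T_q(f) F_q(g))` for `f, g ∈ R^J`, with
`R^M`-linear maps `T_q : R^J → R^{K_q}`. Both atomic Leibniz rules are of this shape: the rightward
one has `F_q = 1`, and the leftward one has `F_q = ∂_{q^core}`. -/
def HasLeibnizRule (R : Realization cs k V) {J M : Set B} (hJM : J ⊆ M) {Q : Type*} {K : Q → Set B}
    (hKM : ∀ q, K q ⊆ M) (w : W) (D : Module.End k R.Poly) (E F : Q → Module.End k R.Poly) : Prop :=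
  ∃ T : ∀ q, R.invariantsOver hJM →ₗ[R.invariants M] R.invariantsOver (hKM q),
    ∀ f g : R.invariantsOver hJM, D (f * g : R.Poly) =
      R.act w (f : R.Poly) * D (g : R.Poly) + ∑ᶠ q, E q ((T q f : R.Poly) * F q (g : R.Poly))

namespace IsScalarExtension

variable {R : Realization cs k V} {R' : Realization cs k' V'} {j : A →ₐ[k] R'.Poly}
variable {p : V →ₗ[k] V'} (h : IsScalarExtension R R' j p)
include h

theorem act_scalar (w : W) (a : A) : R'.act w (j a) = j a := by
  induction w using cs.simple_induction with
  | simple s => exact h.act_simple_scalar s a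
  | one => rw [act_one, AlgHom.id_apply]
  | mul w w' hw hw' => rw [act_mul, AlgHom.comp_apply, hw', hw]

theorem extendsAlong_act (w : W) : ExtendsAlong j (polyMap p) (R.act w) (R'.act w) := by
  intro a f
  rw [map_mul, h.act_scalar, h.polyMap_act]

theorem extendsAlong_demazure (w : W) :
    ExtendsAlong j (polyMap p) (R.demazure w) (R'.demazure w) := by
  unfold demazure
  intro a f
  induction reducedWord cs w with
  | nil => simp
  | cons s ω ih =>
    rw [List.map_cons, List.prod_cons, Module.End.mul_apply, ih,
      h.rootsRegular.demazureSimple_mul (h.act_simple_scalar s a), ← h.polyMap_demazureSimple,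
      List.map_cons, List.prod_cons, Module.End.mul_apply]

theorem mul_mem_invariants {I : Set B} (a : A) {f : R.Poly} (hf : f ∈ R.invariants I) :
    j a * polyMap p f ∈ R'.invariants I :=
  mul_mem (fun w _ => h.act_scalar w a) (h.polyMap_mem_invariants hf)

theorem poly_induction {motive : R'.Poly → Prop}
    (mul : ∀ a f, motive (j a * polyMap p f))
    (add : ∀ x y, motive x → motive y → motive (x + y)) (x : R'.Poly) : motive x := by
  have hx : x ∈ j.range ⊔ (polyMap p).range := h.range_sup_range ▸ Algebra.mem_top
  refine subalgebra_sup_induction ?_ add hx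
  rintro _ ⟨a, rfl⟩ _ ⟨f, rfl⟩
  exact mul a f

theorem invariants_induction (hR : R.GeneralizedDemazureSurjective) {I : Set B}
    (hI : Finitary cs I) {motive : R'.Poly → Prop}
    (mul : ∀ a, ∀ f ∈ R.invariants I, motive (j a * polyMap p f))
    (add : ∀ x y, motive x → motive y → motive (x + y)) {x : R'.Poly} (hx : x ∈ R'.invariants I) :
    motive x := by
  obtain ⟨P, hP⟩ := hR.exists_demazure_longestElement_eq_one hI
  have hP' : R'.demazure (longestElement cs I) (polyMap p P) = 1 := by
    simpa [hP] using h.extendsAlong_demazure (longestElement cs I) 1 P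
  have hx' : R'.demazure (longestElement cs I) (x * polyMap p P) = x := by
    rw [h.rootsRegular.demazure_mul (longestElement_mem hI) hx, hP', mul_one]
  rw [← hx']
  induction x * polyMap p P using h.poly_induction with
  | mul a f =>
    rw [h.extendsAlong_demazure]
    exact mul a _ (hR.demazure_longestElement_mem hI f)
  | add y z hy hz =>
    rw [map_add]
    exact add _ _ hy hz

theorem exists_linearMap_extendsAlong (hR : R.GeneralizedDemazureSurjective) {M : Set B}
    (hM : Finitary cs M) (θ : R.Poly →ₗ[R.invariants M] R.Poly) :
    ∃ θ' : R'.Poly →ₗ[R'.invariants M] R'.Poly, ExtendsAlong j (polyMap p) θ θ' := by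
  obtain ⟨θ', hθ'⟩ := h.exists_extendsAlong θ
  have hlinear (c : R'.Poly) (hc : c ∈ R'.invariants M) (x : R'.Poly) :
      θ' (c * x) = c * θ' x := by
    refine h.invariants_induction hR hM (motive := fun c => θ' (c * x) = c * θ' x)
      (fun a r hr => ?_) (fun c d hc hd => ?_) hc
    · induction x using h.poly_induction with
      | mul b f =>
        have hθr : θ (r * f) = r * θ f := θ.map_smul ⟨r, hr⟩ f
        rw [mul_mul_mul_comm, ← map_mul, ← map_mul, hθ', hθ', hθr, map_mul, map_mul,
          mul_mul_mul_comm]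
      | add x y hx hy => simp only [mul_add, map_add, hx, hy]
    · simp only [add_mul, map_add, hc, hd]
  exact ⟨{ θ' with map_smul' := fun c x => hlinear c c.2 x }, hθ'⟩

theorem mem_invariants_of_extendsAlong {I : Set B} {θ : R.Poly → R.Poly} {θ' : R'.Poly →+ R'.Poly}
    (hθ' : ExtendsAlong j (polyMap p) θ θ') (hθ : ∀ f, θ f ∈ R.invariants I) (x : R'.Poly) :
    θ' x ∈ R'.invariants I := by
  induction x using h.poly_induction with
  | mul a f => exact hθ' a f ▸ h.mul_mem_invariants a (hθ f)
  | add x y hx hy => exact map_add θ' x y ▸ add_mem hx hy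

theorem leibniz_of_extendsAlong (hR : R.GeneralizedDemazureSurjective) {I : Set B}
    (hI : Finitary cs I) {Q : Type*} [Fintype Q] (w : W)
    {D : R.Poly → R.Poly} {D' : R'.Poly →+ R'.Poly} (hD : ExtendsAlong j (polyMap p) D D')
    {E F T : Q → R.Poly → R.Poly} {E' F' T' : Q → R'.Poly →+ R'.Poly}
    (hE : ∀ q, ExtendsAlong j (polyMap p) (E q) (E' q))
    (hF : ∀ q, ExtendsAlong j (polyMap p) (F q) (F' q))
    (hT : ∀ q, ExtendsAlong j (polyMap p) (T q) (T' q))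
    (hleibniz : ∀ f ∈ R.invariants I, ∀ g ∈ R.invariants I,
      D (f * g) = R.act w f * D g + ∑ q, E q (T q f * F q g))
    {x y : R'.Poly} (hx : x ∈ R'.invariants I) (hy : y ∈ R'.invariants I) :
    D' (x * y) = R'.act w x * D' y + ∑ q, E' q (T' q x * F' q y) := by
  have hmul (a b : A) (f g : R.Poly) : j a * polyMap p f * (j b * polyMap p g) =
      j (a * b) * polyMap p (f * g) := by
    rw [map_mul, map_mul, mul_mul_mul_comm]
  refine h.invariants_induction hR hI (fun a f hf => ?_) (fun x₁ x₂ hx₁ hx₂ => ?_) hx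
    (motive := fun x => D' (x * y) = R'.act w x * D' y + ∑ q, E' q (T' q x * F' q y))
  · refine h.invariants_induction hR hI (fun b g hg => ?_) (fun y₁ y₂ hy₁ hy₂ => ?_) hy
      (motive := fun y => D' (j a * polyMap p f * y) = R'.act w (j a * polyMap p f) * D' y +
        ∑ q, E' q (T' q (j a * polyMap p f) * F' q y))
    · simp only [hmul, hD _ _, hE _ _ _, hF _ _ _, hT _ _ _, h.extendsAlong_act _ _ _,
        hleibniz f hf g hg, map_add, map_sum, mul_add, Finset.mul_sum]
    · simp only [mul_add, map_add, hy₁, hy₂, Finset.sum_add_distrib]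
      ring
  · simp only [add_mul, map_add, hx₁, hx₂, Finset.sum_add_distrib]
    ring

theorem hasLeibnizRule (hR : R.GeneralizedDemazureSurjective) {J M : Set B} (hM : Finitary cs M)
    (hJM : J ⊆ M) {Q : Type*} [Finite Q] {K : Q → Set B} (hKM : ∀ q, K q ⊆ M) (w : W)
    {D : Module.End k R.Poly} {D' : Module.End k' R'.Poly} (hD : ExtendsAlong j (polyMap p) D D')
    {E F : Q → Module.End k R.Poly} {E' F' : Q → Module.End k' R'.Poly}
    (hE : ∀ q, ExtendsAlong j (polyMap p) (E q) (E' q))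
    (hF : ∀ q, ExtendsAlong j (polyMap p) (F q) (F' q))
    (hleibniz : R.HasLeibnizRule hJM hKM w D E F) : R'.HasLeibnizRule hJM hKM w D' E' F' := by
  obtain ⟨T, hT⟩ := hleibniz
  have hJ := hM.mono hJM
  obtain ⟨π, hπ⟩ := hR.exists_retraction hJM hJ
  let θ q : R.Poly →ₗ[R.invariants M] R.Poly := (R.invariantsOver (hKM q)).subtype ∘ₗ T q ∘ₗ π
  have hθ q (f : R.invariantsOver hJM) : θ q f = T q f :=
    congrArg (fun x => (T q x : R.Poly)) (DFunLike.congr_fun hπ f)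
  choose θ' hθ' using fun q => h.exists_linearMap_extendsAlong hR hM (θ q)
  have hmem q (x : R'.Poly) : θ' q x ∈ R'.invariants (K q) :=
    h.mem_invariants_of_extendsAlong (θ' := (θ' q).toAddMonoidHom) (hθ' q)
      (fun f => (T q (π f)).2) x
  refine ⟨fun q => (θ' q).codRestrict (R'.invariantsOver (hKM q)) (hmem q) ∘ₗ
    (R'.invariantsOver hJM).subtype, fun x y => ?_⟩
  have := Fintype.ofFinite Q
  simp only [finsum_eq_sum_of_fintype] at hT ⊢
  refine h.leibniz_of_extendsAlong hR hJ w (D' := D'.toAddMonoidHom)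
    (E' := fun q => (E' q).toAddMonoidHom) (F' := fun q => (F' q).toAddMonoidHom)
    (T' := fun q => (θ' q).toAddMonoidHom) hD hE hF hθ' (fun f hf g hg => ?_) x.2 y.2
  rw [hT ⟨f, hf⟩ ⟨g, hg⟩]
  simp only [← hθ]

theorem rightwardRule (hR : R.GeneralizedDemazureSurjective) {d : AtomicDatum cs}
    (hd : R.RightwardRule d) : R'.RightwardRule d :=
  h.hasLeibnizRule hR d.finitary d.J_subset
    (fun q : {q : Coset cs d.I d.J // q.Lt d.coset} => d.rightRed_subset q.1) d.coset.min
    (h.extendsAlong_demazure _) (fun _ => h.extendsAlong_demazure _) (F := fun _ => 1)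
    (F' := fun _ => 1) (fun _ _ _ => rfl) hd

theorem leftwardRule (hR : R.GeneralizedDemazureSurjective) {d : AtomicDatum cs}
    (hd : R.LeftwardRule d) : R'.LeftwardRule d :=
  h.hasLeibnizRule hR d.finitary d.J_subset
    (fun q : {q : Coset cs d.I d.J // q.Lt d.coset} => d.leftRed_subset q.1) d.coset.min
    (h.extendsAlong_demazure _) (fun _ => h.extendsAlong_demazure _)
    (fun _ => h.extendsAlong_demazure _) hd

end IsScalarExtension

end ScalarExtension

section Constructions

variable {B : Type uB} {W : Type uW} [Group W] {m : CoxeterMatrix B} {cs : CoxeterSystem m W}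
variable {k : Type uk} {V : Type uV} [CommRing k] [AddCommGroup V] [Module k V]
variable (R : Realization cs k V)

theorem isHom_specialization (k' : Type uk') [CommRing k'] [Algebra k k'] :
    IsHom R (R.specialization k') (TensorProduct.mk k k' V 1) where
  map_root _ := rfl
  coroot_map s v := by simp [specialization, Algebra.smul_def]

theorem isScalarExtension_specialization (k' : Type uk') [CommRing k'] [Algebra k k']
    (hroot : ∀ s, Function.Surjective fun φ : Module.Dual k V => φ (R.root s)) :
    IsScalarExtension R (R.specialization k')
      (IsScalarTower.toAlgHom k k' (R.specialization k').Poly) (TensorProduct.mk k k' V 1) where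
  toIsHom := R.isHom_specialization k'
  rootsRegular s := by
    obtain ⟨φ, hφ⟩ := hroot s 1
    refine isRegular_ι_of_dual_eq_one (φ.baseChange k') ?_
    simp [specialization, show φ (R.root s) = 1 from hφ]
  act_simple_scalar s := ((R.specialization k').act (cs.simple s)).commutes
  range_sup_range := by
    refine eq_top_of_algebraMap_mem_of_ι_mem
      (fun c => Algebra.mem_sup_left ⟨c, rfl⟩) fun x => ?_
    induction x using TensorProduct.induction_on with
    | zero => rw [map_zero]; exact zero_mem _
    | tmul c v =>
      have hcv : ι k' (k' ⊗[k] V) (c ⊗ₜ v) =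
          algebraMap k' _ c * polyMap (TensorProduct.mk k k' V 1) (ι k V v) := by
        rw [polyMap_ι, ← Algebra.smul_def, ← map_smul, TensorProduct.mk_apply,
          TensorProduct.smul_tmul', smul_eq_mul, mul_one]
      rw [hcv]
      exact mul_mem (Algebra.mem_sup_left ⟨c, rfl⟩) (Algebra.mem_sup_right ⟨_, rfl⟩)
    | add x y hx hy => rw [map_add]; exact add_mem hx hy
  exists_extendsAlong θ := by
    let τ : SymmetricAlgebra k' (k' ⊗[k] V) →ₐ[k'] k' ⊗[k] SymmetricAlgebra k V :=
      lift ((ι k V).baseChange k')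
    have hτ : (τ.restrictScalars k).comp (polyMap (TensorProduct.mk k k' V 1)) =
        Algebra.TensorProduct.includeRight := by
      apply SymmetricAlgebra.algHom_ext
      ext v
      simp [τ, polyMap_ι]
    exact exists_extendsAlong_of_tensor (τ.restrictScalars k) τ.commutes (DFunLike.congr_fun hτ)
      (θ.restrictScalars k)

theorem isHom_enlargement (N : Type uN) [AddCommGroup N] [Module k N] [Module.Free k N]
    [Module.Finite k N] : IsHom R (R.enlargement N) (LinearMap.inl k V N) where
  map_root _ := rfl
  coroot_map _ _ := rfl

theorem isScalarExtension_enlargement (N : Type uN) [AddCommGroup N] [Module k N] [Module.Free k N]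
    [Module.Finite k N] (hroot : ∀ s, Function.Surjective fun φ : Module.Dual k V => φ (R.root s)) :
    IsScalarExtension R (R.enlargement N) (polyMap (LinearMap.inr k V N))
      (LinearMap.inl k V N) where
  toIsHom := R.isHom_enlargement N
  rootsRegular s := by
    obtain ⟨φ, hφ⟩ := hroot s 1
    exact isRegular_ι_of_dual_eq_one (φ ∘ₗ LinearMap.fst k V N) hφ
  act_simple_scalar s := by
    have hact : ((R.enlargement N).act (cs.simple s)).comp (polyMap (LinearMap.inr k V N)) =
        polyMap (LinearMap.inr k V N) := by
      apply SymmetricAlgebra.algHom_ext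
      ext x
      simp [act_ι, polyMap_ι, rep_simple, reflectionMap_apply, enlargement]
    exact DFunLike.congr_fun hact
  range_sup_range := by
    refine eq_top_of_algebraMap_mem_of_ι_mem (Subalgebra.algebraMap_mem _) fun ⟨v, x⟩ => ?_
    have hvx : ι k (V × N) (v, x) = polyMap (LinearMap.inr k V N) (ι k N x) +
        polyMap (LinearMap.inl k V N) (ι k V v) := by
      rw [polyMap_ι, polyMap_ι, ← map_add]
      simp
    rw [hvx]
    exact add_mem (Algebra.mem_sup_left ⟨_, rfl⟩) (Algebra.mem_sup_right ⟨_, rfl⟩)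
  exists_extendsAlong θ := by
    let τ : SymmetricAlgebra k (V × N) →ₐ[k] SymmetricAlgebra k N ⊗[k] SymmetricAlgebra k V :=
      lift (LinearMap.coprod
        (Algebra.TensorProduct.includeRight.toLinearMap ∘ₗ ι k V)
        (Algebra.TensorProduct.includeLeft.toLinearMap ∘ₗ ι k N))
    have hinr : τ.comp (polyMap (LinearMap.inr k V N)) = Algebra.TensorProduct.includeLeft := by
      apply SymmetricAlgebra.algHom_ext
      ext x
      simp [τ, polyMap_ι]
    have hinl : τ.comp (polyMap (LinearMap.inl k V N)) = Algebra.TensorProduct.includeRight := by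
      apply SymmetricAlgebra.algHom_ext
      ext v
      simp [τ, polyMap_ι]
    exact exists_extendsAlong_of_tensor τ (DFunLike.congr_fun hinr) (DFunLike.congr_fun hinl)
      (θ.restrictScalars k)

namespace QuotientDatum

variable {R} (D : R.QuotientDatum)

theorem isHom : IsHom R (Realization.quotient D) D.proj where
  map_root _ := rfl
  coroot_map s v := D.coroot_proj s v

theorem polyMap_proj_polyMap_subtype (f : SymmetricAlgebra k D.Y) :
    polyMap D.proj (polyMap D.Y.subtype f) = f := by
  have hcomp : (polyMap D.proj).comp (polyMap D.Y.subtype) = AlgHom.id k _ := by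
    apply SymmetricAlgebra.algHom_ext
    ext y
    simp [polyMap_ι, proj]
  exact DFunLike.congr_fun hcomp f

theorem ι_mem_invariants (M : Set B) {x : V} (hx : x ∈ D.X) : ι k V x ∈ R.invariants M :=
  fun w _ => by rw [act_ι, D.trivial w x hx]

theorem sub_proj_mem (v : V) : v - D.proj v ∈ D.X := by
  refine (Submodule.projectionOnto_apply_eq_zero_iff D.isCompl.symm).1 ?_
  rw [map_sub, sub_eq_zero]
  exact (Submodule.projectionOnto_apply_left D.isCompl.symm (D.proj v)).symm

theorem polyMap_proj_map_mul_polyMap_subtype {M : Set B} (θ : R.Poly →ₗ[R.invariants M] R.Poly)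
    (c f : R.Poly) :
    (polyMap D.proj (θ (c * polyMap D.Y.subtype (polyMap (k' := k) D.proj f))) :
      (Realization.quotient D).Poly) = polyMap D.proj (θ (c * f)) := by
  induction f using SymmetricAlgebra.induction generalizing c with
  | algebraMap r => rw [AlgHom.commutes, AlgHom.commutes]
  | ι v =>
    have hθ : θ (ι k V (v - D.proj v) * c) = ι k V (v - D.proj v) * θ c :=
      θ.map_smul ⟨_, D.ι_mem_invariants M (D.sub_proj_mem v)⟩ c
    have hproj : D.proj (v - D.proj v) = 0 :=
      (Submodule.projectionOnto_apply_eq_zero_iff D.isCompl.symm).2 (D.sub_proj_mem v)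
    have hker : polyMap (k' := k) D.proj (ι k V (v - D.proj v)) = 0 := by
      rw [polyMap_ι, hproj, map_zero]
    have hdiff : polyMap (k' := k) D.proj (θ (ι k V (v - D.proj v) * c)) = 0 := by
      rw [hθ, map_mul, hker, zero_mul]
    rw [mul_comm, map_sub, mul_sub, map_sub, map_sub, sub_eq_zero] at hdiff
    rw [hdiff, polyMap_ι, polyMap_ι, Submodule.subtype_apply]
  | mul f g hf hg =>
    rw [map_mul (polyMap D.proj), map_mul (polyMap D.Y.subtype), ← mul_assoc, hg,
      mul_right_comm, hf, mul_right_comm, mul_assoc]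
  | add f g hf hg => simp only [map_add, mul_add, hf, hg]

theorem isScalarExtension :
    IsScalarExtension R (Realization.quotient D) (Algebra.ofId k (Realization.quotient D).Poly)
      D.proj where
  toIsHom := D.isHom
  rootsRegular s := by
    obtain ⟨φ, hφ⟩ := D.surjective s 1
    exact isRegular_ι_of_dual_eq_one φ hφ
  act_simple_scalar s := ((Realization.quotient D).act (cs.simple s)).commutes
  range_sup_range :=
    Algebra.eq_top_iff.2 fun f =>
      Algebra.mem_sup_right ⟨polyMap D.Y.subtype f, D.polyMap_proj_polyMap_subtype f⟩
  exists_extendsAlong θ := by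
    refine ⟨(polyMap D.proj).toLinearMap ∘ₗ θ.restrictScalars k ∘ₗ
      (polyMap D.Y.subtype).toLinearMap, fun a f => ?_⟩
    have hf := D.polyMap_proj_map_mul_polyMap_subtype θ 1 f
    rw [one_mul, one_mul] at hf
    rw [Algebra.ofId_apply, ← Algebra.smul_def, ← Algebra.smul_def, map_smul]
    exact congrArg (a • ·) hf

end QuotientDatum

end Constructions

end Realization

end AtomicLeibniz

end

theorem mainTheorem8_general
    {B : Type uB} {W : Type uW} [Group W] {m : CoxeterMatrix B} (cs : CoxeterSystem m W)
    {k : Type uk} {V : Type uV} [CommRing k] [AddCommGroup V] [Module k V]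
    (R : AtomicLeibniz.Realization cs k V) (hR : R.GeneralizedDemazureSurjective)
    (d : AtomicLeibniz.AtomicDatum cs) :
    (R.RightwardRule d →
      (∀ (k' : Type uk') [CommRing k'] [Algebra k k'], (R.specialization k').RightwardRule d) ∧
      (∀ (N : Type uN) [AddCommGroup N] [Module k N] [Module.Free k N] [Module.Finite k N],
        (R.enlargement N).RightwardRule d) ∧
      (∀ D : R.QuotientDatum, (AtomicLeibniz.Realization.quotient D).RightwardRule d)) ∧
    (R.LeftwardRule d →
      (∀ (k' : Type uk') [CommRing k'] [Algebra k k'], (R.specialization k').LeftwardRule d) ∧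
      (∀ (N : Type uN) [AddCommGroup N] [Module k N] [Module.Free k N] [Module.Finite k N],
        (R.enlargement N).LeftwardRule d) ∧
      (∀ D : R.QuotientDatum, (AtomicLeibniz.Realization.quotient D).LeftwardRule d)) := by
  refine ⟨fun h => ⟨fun k' _ _ => ?_, fun N _ _ _ _ => ?_, fun D => ?_⟩,
    fun h => ⟨fun k' _ _ => ?_, fun N _ _ _ _ => ?_, fun D => ?_⟩⟩
  · exact (R.isScalarExtension_specialization k' hR.root_surjective).rightwardRule hR h
  · exact (R.isScalarExtension_enlargement N hR.root_surjective).rightwardRule hR h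
  · exact D.isScalarExtension.rightwardRule hR h
  · exact (R.isScalarExtension_specialization k' hR.root_surjective).leftwardRule hR h
  · exact (R.isScalarExtension_enlargement N hR.root_surjective).leftwardRule hR h
  · exact D.isScalarExtension.leftwardRule hR h

theorem mainTheorem8
    {B : Type uB} {W : Type uW} [Group W] {m : CoxeterMatrix B} (cs : CoxeterSystem m W)
    {k : Type uk} {V : Type uV} [CommRing k] [AddCommGroup V] [Module k V]
    (R : AtomicLeibniz.Realization cs k V) (hR : R.IsFrobenius) (d : AtomicLeibniz.AtomicDatum cs) :
    (R.RightwardRule d →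
      (∀ (k' : Type uk') [CommRing k'] [Algebra k k'], (R.specialization k').RightwardRule d) ∧
      (∀ (N : Type uN) [AddCommGroup N] [Module k N] [Module.Free k N] [Module.Finite k N],
        (R.enlargement N).RightwardRule d) ∧
      (∀ D : R.QuotientDatum, (AtomicLeibniz.Realization.quotient D).RightwardRule d)) ∧
    (R.LeftwardRule d →
      (∀ (k' : Type uk') [CommRing k'] [Algebra k k'], (R.specialization k').LeftwardRule d) ∧
      (∀ (N : Type uN) [AddCommGroup N] [Module k N] [Module.Free k N] [Module.Finite k N],
        (R.enlargement N).LeftwardRule d) ∧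
      (∀ D : R.QuotientDatum, (AtomicLeibniz.Realization.quotient D).LeftwardRule d)) :=
  mainTheorem8_general cs R hR.surjective d
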